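/- Let $\mathcal G$ be a finite directed acyclic graph (DAG) whose vertex set is partitioned into observed and latent vertices, where no latent vertex has a parent. To each observed vertex $V$ associate a discrete (countable, non-empty) state space. The model defined by the observed margin of $\mathcal G$ is the set of all distributions of the observed variables of the form $$p(\text{observed})=\int \prod_{V} f(V\mid \mathrm{pa}_{\mathcal G}(V))\,dU ,$$ where the product is over all vertices, $\mathrm{pa}_{\mathcal G}(V)$ is the set of parents of $V$, the integral is over the latent variables $U$, each factor is a conditional probability density (a conditional probability mass function for observed $V$), and the latent variables may take values in arbitrary measurable spaces, with densities taken relative to arbitrary $\sigma$-finite reference measures. Let $X$ and $Y$ be two distinct observed vertices that are neither adjacent nor share a latent parent, such that the state spaces of $X$ and $Y$ each have at least two elements, and such that the graph $\mathcal G'$ obtained from $\mathcal G$ by adding the edge $X\to Y$ is again acyclic. Then the observed-margin model of $\mathcal G'$ is strictly larger than that of $\mathcal G$ (for the same observed state spaces): it contains every distribution in the model of $\mathcal G$, and at least one distribution that is not in it. In other words, $\mathcal G$ imposes a non-trivial (falsifiable) constraint on the observed distribution. -/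

import Mathlib

open MeasureTheory
open scoped ENNReal

universe uO uL uX uΩ

namespace LatentDAG

/-- A directed graph is acyclic if there is no directed path (of length at least one) from a
vertex to itself; in particular it has no loops. -/
def IsAcyclic {V : Type*} (G : Digraph V) : Prop :=
  ∀ v : V, ¬ Relation.TransGen G.Adj v v

/-- The directed graph obtained from `G` by adding the edge `a → b`. -/
def addEdge {V : Type*} (G : Digraph V) (a b : V) : Digraph V where
  Adj v w := G.Adj v w ∨ (v = a ∧ w = b)

section Model

variable {O : Type uO} {L : Type uL} [Fintype O] [Fintype L] [DecidableEq O] [DecidableEq L]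

/-- The vertex set is `O ⊕ L`, with `O` the observed and `L` the latent vertices. An observed vertex
`o` has the discrete state space `X o` (reference measure: counting measure) and a latent vertex `l`
has the measurable state space `Ω l` with reference measure `ν l`.

`IsCondDensities G X Ω ν f` says that `f` is a family of conditional densities
`f v = f(v | pa_G(v))`, one for each vertex `v`, written as functions of a full configuration
`(x, u)` of the observed and the latent variables. -/
structure IsCondDensities (G : Digraph (O ⊕ L)) (X : O → Type uX) (Ω : L → Type uΩ)
    [∀ l, MeasurableSpace (Ω l)] (ν : ∀ l, Measure (Ω l))
    (f : O ⊕ L → (∀ o, X o) → (∀ l, Ω l) → ℝ≥0∞) : Prop where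
  /-- Measurability (the observed coordinates are discrete). -/
  measurable : ∀ v x, Measurable (f v x)
  /-- `f v` is a function of the coordinate `v` and of the coordinates of the parents of `v`. -/
  local_dep : ∀ (v : O ⊕ L) (x x' : ∀ o, X o) (u u' : ∀ l, Ω l),
    (∀ o, (Sum.inl o = v ∨ G.Adj (Sum.inl o) v) → x o = x' o) →
    (∀ l, (Sum.inr l = v ∨ G.Adj (Sum.inr l) v) → u l = u' l) →
    f v x u = f v x' u'
  /-- For an observed vertex, `f o` is a probability mass function given each value of the
  parents. -/
  sum_eq_one : ∀ (o : O) (x : ∀ o, X o) (u : ∀ l, Ω l),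
    ∑' a : X o, f (Sum.inl o) (Function.update x o a) u = 1
  /-- For a latent vertex, `f l` is a probability density with respect to `ν l` given each value of
  the parents. -/
  lintegral_eq_one : ∀ (l : L) (x : ∀ o, X o) (u : ∀ l, Ω l),
    ∫⁻ t, f (Sum.inr l) x (Function.update u l t) ∂(ν l) = 1

/-- The model defined by the observed margin of `G`, for observed variables with discrete state
spaces `X o`: all distributions `p` of the observed variables such that, for some state spaces `Ω l`
of the latent variables (arbitrary measurable spaces with σ-finite reference measures) and some
conditional densities `f v = f(v | pa_G(v))`, the distribution `p` is the margin
`∫ ∏ v, f(v | pa_G(v)) du` of the joint distribution that factorizes according to `G`. -/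
def observedModel (G : Digraph (O ⊕ L)) (X : O → Type uX) : Set (PMF (∀ o, X o)) :=
  {p | ∃ (Ω : L → Type uΩ) (_ : ∀ l, MeasurableSpace (Ω l)) (ν : ∀ l, Measure (Ω l))
      (_ : ∀ l, SigmaFinite (ν l)) (f : O ⊕ L → (∀ o, X o) → (∀ l, Ω l) → ℝ≥0∞),
      IsCondDensities G X Ω ν f ∧
      ∀ x : ∀ o, X o, p x = ∫⁻ u, ∏ v : O ⊕ L, f v x u ∂(Measure.pi ν)}

end Model

end LatentDAG

/-! ### Integration against finite product measures. -/

namespace MeasureTheory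

/-! Freeze every observed variable except those at `a` and `b`. In the model of `G` the factors of
`a` and `b` ignore each other's value and involve disjoint sets of independent latents, while all
other observed factors are at most `1`. Hence the slice of `p` is dominated by a product `A s * B t`
with `A s + A s' ≤ 1` and `B t + B t' ≤ 1` (`exists_le_mul_of_mem_observedModel`). With the edge `a
→ b`, `X b` may copy `X a`, placing mass one half on each of two points that differ in both
coordinates (`map_update_mem_observedModel`). No such product dominates this: `A * B + A' * B'`
would be at least `1`, yet it is less than `(A + A') * (B + B') ≤ 1` by positive cross terms
(`not_half_le_mul`). -/

/-- **Tonelli's theorem** for a product of functions of one coordinate each, indexed by `Fin n`. -/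
theorem lintegral_fin_nat_prod_eq_prod {n : ℕ} {E : Fin n → Type*}
    {mE : ∀ i, MeasurableSpace (E i)} {μ : (i : Fin n) → Measure (E i)} [∀ i, SigmaFinite (μ i)]
    {f : (i : Fin n) → E i → ℝ≥0∞} (hf : ∀ i, Measurable (f i)) :
    ∫⁻ x : (i : Fin n) → E i, ∏ i, f i (x i) ∂(Measure.pi μ) = ∏ i, ∫⁻ x, f i x ∂(μ i) := by
  induction n with
  | zero => simp
  | succ n ih =>
    rw [← ((measurePreserving_piFinSuccAbove μ 0).symm).lintegral_comp_emb
      (MeasurableEquiv.measurableEmbedding _), Fin.prod_univ_succ,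
      ← ih (μ := fun i => μ i.succ) (f := fun i => f i.succ) fun i => hf _,
      ← lintegral_prod_mul (hf 0).aemeasurable
        (Finset.measurable_prod _ fun i _ =>
          (hf i.succ).comp (measurable_pi_apply i)).aemeasurable]
    refine lintegral_congr fun z => ?_
    rw [Fin.prod_univ_succ]
    rfl

/-- **Tonelli's theorem** for a product of functions of one coordinate each. -/
theorem lintegral_fintype_prod_eq_prod {ι : Type*} [Fintype ι] {E : ι → Type*}
    {mE : ∀ i, MeasurableSpace (E i)} {μ : (i : ι) → Measure (E i)} [∀ i, SigmaFinite (μ i)]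
    {f : (i : ι) → E i → ℝ≥0∞} (hf : ∀ i, Measurable (f i)) :
    ∫⁻ x : (i : ι) → E i, ∏ i, f i (x i) ∂(Measure.pi μ) = ∏ i, ∫⁻ x, f i x ∂(μ i) := by
  let e := (Fintype.equivFin ι).symm
  rw [← (measurePreserving_piCongrLeft μ e).lintegral_comp_emb
    (MeasurableEquiv.measurableEmbedding _)]
  simp_rw [← e.prod_comp, MeasurableEquiv.coe_piCongrLeft, Equiv.piCongrLeft_apply_apply]
  exact lintegral_fin_nat_prod_eq_prod (μ := fun i => μ (e i)) (f := fun i => f (e i))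
    fun i => hf _

/-- Lets the latent densities be absorbed into the reference measures, so that the latents become
independent random variables. -/
theorem Measure.pi_withDensity {ι : Type*} [Fintype ι] {E : ι → Type*}
    {mE : ∀ i, MeasurableSpace (E i)} (μ : (i : ι) → Measure (E i)) [∀ i, SigmaFinite (μ i)]
    {f : (i : ι) → E i → ℝ≥0∞} (hf : ∀ i, Measurable (f i))
    [∀ i, SigmaFinite ((μ i).withDensity (f i))] :
    Measure.pi (fun i => (μ i).withDensity (f i)) =
      (Measure.pi μ).withDensity fun x => ∏ i, f i (x i) := by
  refine Measure.pi_eq (μ := fun i => (μ i).withDensity (f i)) fun s hs => ?_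
  rw [withDensity_apply _ (MeasurableSet.univ_pi hs), Measure.restrict_pi_pi,
    lintegral_fintype_prod_eq_prod hf]
  exact Finset.prod_congr rfl fun i _ => (withDensity_apply _ (hs i)).symm

/-- Under a product probability measure, functions of complementary sets of coordinates are
independent. -/
theorem lintegral_mul_of_dependsOn {ι : Type*} [Fintype ι] {E : ι → Type*}
    {mE : ∀ i, MeasurableSpace (E i)} (μ : (i : ι) → Measure (E i))
    [∀ i, IsProbabilityMeasure (μ i)] {s : Set ι} {F H : (∀ i, E i) → ℝ≥0∞}
    (hF : Measurable F) (hH : Measurable H) (hFs : DependsOn F s) (hHs : DependsOn H sᶜ) :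
    ∫⁻ u, F u * H u ∂(Measure.pi μ) =
      (∫⁻ u, F u ∂(Measure.pi μ)) * ∫⁻ u, H u ∂(Measure.pi μ) := by
  classical
  obtain ⟨u₀⟩ : Nonempty (∀ i, E i) := nonempty_of_isProbabilityMeasure (Measure.pi μ)
  let e := MeasurableEquiv.piEquivPiSubtypeProd E (· ∈ s)
  have he := measurePreserving_piEquivPiSubtypeProd μ (· ∈ s)
  -- Freezing the irrelevant coordinates at `u₀` makes `F` and `H` functions of the two separate
  -- factors of the split product.
  have hF' : Measurable fun w => F (e.symm (w, (e u₀).2)) := by fun_prop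
  have hH' : Measurable fun w => H (e.symm ((e u₀).1, w)) := by fun_prop
  have eF : ∀ u, F u = F (e.symm ((e u).1, (e u₀).2)) := fun u => hFs fun i hi => by
    change u i = (Equiv.piEquivPiSubtypeProd (· ∈ s) E).symm _ i
    rw [Equiv.piEquivPiSubtypeProd_symm_apply, dif_pos hi]
    rfl
  have eH : ∀ u, H u = H (e.symm ((e u₀).1, (e u).2)) := fun u => hHs fun i hi => by
    change u i = (Equiv.piEquivPiSubtypeProd (· ∈ s) E).symm _ i
    rw [Equiv.piEquivPiSubtypeProd_symm_apply, dif_neg hi]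
    rfl
  have h1 : ∫⁻ u, F u ∂(Measure.pi μ) = ∫⁻ w, F (e.symm (w, (e u₀).2)) ∂Measure.pi fun i : s => μ i := by
    rw [lintegral_congr eF, ← (measurePreserving_fst.comp he).lintegral_comp hF']
    rfl
  have h2 : ∫⁻ u, H u ∂(Measure.pi μ) = ∫⁻ w, H (e.symm ((e u₀).1, w))
      ∂Measure.pi fun i : {i // i ∉ s} => μ i := by
    rw [lintegral_congr eH, ← (measurePreserving_snd.comp he).lintegral_comp hH']
    rfl
  rw [h1, h2, ← lintegral_prod_mul hF'.aemeasurable hH'.aemeasurable,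
    ← he.lintegral_comp (by fun_prop)]
  exact lintegral_congr fun u => by rw [eF u, eH u]

end MeasureTheory

/-! ### The constraint imposed by `G`, and a distribution that violates it. -/

namespace LatentDAG

section

variable {O : Type uO} {L : Type uL} [DecidableEq O] [DecidableEq L]
  {G : Digraph (O ⊕ L)} {X : O → Type uX}

theorem IsCondDensities.mono {G' : Digraph (O ⊕ L)} (h : ∀ v w, G.Adj v w → G'.Adj v w)
    {Ω : L → Type uΩ} [∀ l, MeasurableSpace (Ω l)] {ν : ∀ l, Measure (Ω l)}
    {f : O ⊕ L → (∀ o, X o) → (∀ l, Ω l) → ℝ≥0∞} (hf : IsCondDensities G X Ω ν f) :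
    IsCondDensities G' X Ω ν f where
  measurable := hf.measurable
  local_dep v x x' u u' hx hu := hf.local_dep v x x' u u'
    (fun o ho => hx o (ho.imp_right (h _ _))) fun l hl => hu l (hl.imp_right (h _ _))
  sum_eq_one := hf.sum_eq_one
  lintegral_eq_one := hf.lintegral_eq_one

theorem IsCondDensities.observed_le_one {Ω : L → Type uΩ} [∀ l, MeasurableSpace (Ω l)]
    {ν : ∀ l, Measure (Ω l)} {f : O ⊕ L → (∀ o, X o) → (∀ l, Ω l) → ℝ≥0∞}
    (hf : IsCondDensities G X Ω ν f) (o : O) (x : ∀ o, X o) (u : ∀ l, Ω l) :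
    f (Sum.inl o) x u ≤ 1 := by
  rw [← hf.sum_eq_one o x u]
  simpa using ENNReal.le_tsum (f := fun a => f (Sum.inl o) (Function.update x o a) u) (x o)

theorem IsCondDensities.observed_add_le_one {Ω : L → Type uΩ} [∀ l, MeasurableSpace (Ω l)]
    {ν : ∀ l, Measure (Ω l)} {f : O ⊕ L → (∀ o, X o) → (∀ l, Ω l) → ℝ≥0∞}
    (hf : IsCondDensities G X Ω ν f) (o : O) (x : ∀ o, X o) (u : ∀ l, Ω l)
    {s t : X o} (hst : s ≠ t) :
    f (Sum.inl o) (Function.update x o s) u + f (Sum.inl o) (Function.update x o t) u ≤ 1 := by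
  classical
  rw [← hf.sum_eq_one o x u, ← Finset.sum_pair
    (f := fun c => f (Sum.inl o) (Function.update x o c) u) hst]
  exact ENNReal.sum_le_tsum _

variable [Fintype O] [Fintype L]

theorem observedModel_mono {G' : Digraph (O ⊕ L)} (h : ∀ v w, G.Adj v w → G'.Adj v w) :
    observedModel.{uO, uL, uX, uΩ} G X ⊆ observedModel.{uO, uL, uX, uΩ} G' X := by
  rintro p ⟨Ω, mΩ, ν, hν, f, hf, hp⟩
  exact ⟨Ω, mΩ, ν, hν, f, hf.mono h, hp⟩

/-- If all variables except `X a` and `X b` are held fixed, the joint probabilities are bounded by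
products of subprobability masses, provided that `a`, `b` are neither adjacent nor share a latent
parent. -/
theorem exists_le_mul_of_mem_observedModel
    (hlatent : ∀ (v : O ⊕ L) (l : L), ¬ G.Adj v (Sum.inr l)) {a b : O} (hab : a ≠ b)
    (hadj : ¬ G.Adj (Sum.inl a) (Sum.inl b) ∧ ¬ G.Adj (Sum.inl b) (Sum.inl a))
    (hconf : ¬ ∃ l : L, G.Adj (Sum.inr l) (Sum.inl a) ∧ G.Adj (Sum.inr l) (Sum.inl b))
    {p : PMF (∀ o, X o)} (hp : p ∈ observedModel.{uO, uL, uX, uΩ} G X) (x₀ : ∀ o, X o) :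
    ∃ (A : X a → ℝ≥0∞) (B : X b → ℝ≥0∞),
      (∀ s s', s ≠ s' → A s + A s' ≤ 1) ∧ (∀ t t', t ≠ t' → B t + B t' ≤ 1) ∧
      ∀ s t, p (Function.update (Function.update x₀ a s) b t) ≤ A s * B t := by
  obtain ⟨Ω, mΩ, ν, hν, f, hf, hp⟩ := hp
  obtain ⟨u₀⟩ : Nonempty (∀ l, Ω l) := by
    -- Over an empty latent space every integral vanishes, but `p` has a point of positive mass.
    by_contra hne
    rw [not_nonempty_iff] at hne
    obtain ⟨x, hx⟩ := p.support_nonempty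
    exact (p.mem_support_iff x).1 hx (by rw [hp, Measure.eq_zero_of_isEmpty (Measure.pi ν),
      lintegral_zero_measure])
  -- Latents have no parents, so the choice of `x₀` and `u₀` is immaterial here.
  let g : ∀ l, Ω l → ℝ≥0∞ := fun l t => f (Sum.inr l) x₀ (Function.update u₀ l t)
  have hg : ∀ l, Measurable (g l) := fun l =>
    (hf.measurable (Sum.inr l) x₀).comp (measurable_update u₀)
  have hfg : ∀ l x u, f (Sum.inr l) x u = g l (u l) := fun l x u => by
    refine hf.local_dep _ _ _ _ _ (fun o ho => ?_) fun l' hl' => ?_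
    · rcases ho with ho | ho
      · cases ho
      · exact absurd ho (hlatent _ _)
    · rcases hl' with hl' | hl'
      · cases hl'
        simp
      · exact absurd hl' (hlatent _ _)
  let μ : ∀ l, Measure (Ω l) := fun l => (ν l).withDensity (g l)
  have hμ : ∀ l, IsProbabilityMeasure (μ l) := fun l => ⟨by
    rw [withDensity_apply _ MeasurableSet.univ, setLIntegral_univ]
    exact hf.lintegral_eq_one l x₀ u₀⟩
  have hμ' : ∀ l, SigmaFinite ((ν l).withDensity (g l)) := fun l =>
    inferInstanceAs (SigmaFinite (μ l))
  let A : X a → (∀ l, Ω l) → ℝ≥0∞ := fun s u => f (Sum.inl a) (Function.update x₀ a s) u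
  let B : X b → (∀ l, Ω l) → ℝ≥0∞ := fun t u => f (Sum.inl b) (Function.update x₀ b t) u
  have hA : ∀ s, Measurable (A s) := fun s => hf.measurable _ _
  have hB : ∀ t, Measurable (B t) := fun t => hf.measurable _ _
  have hAd : ∀ s, DependsOn (A s) {l | G.Adj (Sum.inr l) (Sum.inl a)} := fun s u u' h =>
    hf.local_dep _ _ _ _ _ (fun _ _ => rfl) fun l hl => h l (hl.resolve_left (by simp))
  have hBd : ∀ t, DependsOn (B t) {l | G.Adj (Sum.inr l) (Sum.inl a)}ᶜ := fun t u u' h =>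
    hf.local_dep _ _ _ _ _ (fun _ _ => rfl) fun l hl =>
      h l fun hl' => hconf ⟨l, hl', hl.resolve_left (by simp)⟩
  refine ⟨fun s => ∫⁻ u, A s u ∂(Measure.pi μ), fun t => ∫⁻ u, B t u ∂(Measure.pi μ),
    fun s s' hs => ?_, fun t t' ht => ?_, fun s t => ?_⟩
  · rw [← lintegral_add_left (hA s)]
    exact (lintegral_mono fun u => hf.observed_add_le_one a x₀ u hs).trans_eq (by simp)
  · rw [← lintegral_add_left (hB t)]
    exact (lintegral_mono fun u => hf.observed_add_le_one b x₀ u ht).trans_eq (by simp)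
  · rw [← lintegral_mul_of_dependsOn μ (hA s) (hB t) (hAd s) (hBd t),
      Measure.pi_withDensity ν hg, lintegral_withDensity_eq_lintegral_mul _ (by fun_prop)
        (by fun_prop), hp]
    refine lintegral_mono fun u => ?_
    set x := Function.update (Function.update x₀ a s) b t with hx
    have hxA : f (Sum.inl a) x u = A s u :=
      hf.local_dep _ _ _ _ _ (fun o ho => by
        have hob : o ≠ b := by
          rintro rfl
          rcases ho with ho | ho
          · exact hab (Sum.inl.inj ho).symm
          · exact hadj.2 ho
        rw [hx, Function.update_of_ne hob]) fun _ _ => rfl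
    have hxB : f (Sum.inl b) x u = B t u :=
      hf.local_dep _ _ _ _ _ (fun o ho => by
        by_cases hob : o = b
        · subst hob
          simp [hx]
        have hoa : o ≠ a := by
          rintro rfl
          rcases ho with ho | ho
          · exact hab (Sum.inl.inj ho)
          · exact hadj.1 ho
        rw [hx, Function.update_of_ne hob, Function.update_of_ne hoa,
          Function.update_of_ne hob]) fun _ _ => rfl
    have hO : ∏ o, f (Sum.inl o) x u ≤ A s u * B t u := by
      rw [← Finset.mul_prod_erase _ _ (Finset.mem_univ a), ← Finset.mul_prod_erase _ _
        (Finset.mem_erase.2 ⟨hab.symm, Finset.mem_univ b⟩), hxA, hxB, ← mul_assoc]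
      -- The other factors may depend on both `s` and `t`; bounding them by `1` removes them.
      exact mul_le_of_le_one_right' (Finset.prod_le_one' fun o _ => hf.observed_le_one o x u)
    rw [Fintype.prod_sum_type, mul_comm]
    simp only [hfg, Pi.mul_apply]
    gcongr

/-- A bivariate distribution that puts mass one half on each of two points differing in both
coordinates is not dominated by a product of subprobabilities. -/
theorem not_half_le_mul {A A' B B' : ℝ≥0∞} (hA : A + A' ≤ 1) (hB : B + B' ≤ 1)
    (h : 2⁻¹ ≤ A * B) (h' : 2⁻¹ ≤ A' * B') : False := by
  have nA : A ≠ ⊤ := ne_top_of_le_ne_top ENNReal.one_ne_top (le_self_add.trans hA)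
  have nA' : A' ≠ ⊤ := ne_top_of_le_ne_top ENNReal.one_ne_top (le_add_self.trans hA)
  have nB : B ≠ ⊤ := ne_top_of_le_ne_top ENNReal.one_ne_top (le_self_add.trans hB)
  have nB' : B' ≠ ⊤ := ne_top_of_le_ne_top ENNReal.one_ne_top (le_add_self.trans hB)
  have h2 : (2⁻¹ : ℝ≥0∞) = ((2⁻¹ : NNReal) : ℝ≥0∞) := by simp
  lift A to NNReal using nA
  lift A' to NNReal using nA'
  lift B to NNReal using nB
  lift B' to NNReal using nB'
  rw [h2] at h h'
  norm_cast at hA hB h h'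
  have hA : (A : ℝ) + A' ≤ 1 := by exact_mod_cast hA
  have hB : (B : ℝ) + B' ≤ 1 := by exact_mod_cast hB
  have h : (2⁻¹ : ℝ) ≤ A * B := by exact_mod_cast h
  have h' : (2⁻¹ : ℝ) ≤ A' * B' := by exact_mod_cast h'
  -- Positivity of `A` and `B'` makes the cross term `A * B'` positive, hence the inequality strict.
  have pA : (0 : ℝ) < A := lt_of_le_of_ne A.2 fun h0 => by rw [← h0] at h; norm_num at h
  have pB : (0 : ℝ) < B' := lt_of_le_of_ne B'.2 fun h0 => by rw [← h0] at h'; norm_num at h'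
  have := mul_pos pA pB
  have := mul_nonneg A'.2 B.2
  have : ((A : ℝ) + A') * (B + B') ≤ 1 := mul_le_one₀ hA (by positivity) hB
  nlinarith

/-- If `a` is a parent of `b`, then every distribution under which `X a` has law `q`, `X b` is a
function of `X a` and all other variables are constant belongs to the observed model. -/
theorem map_update_mem_observedModel {a b : O} (hab : a ≠ b)
    (hG : G.Adj (Sum.inl a) (Sum.inl b)) (x₀ : ∀ o, X o) (φ : X a → X b) (q : PMF (X a)) :
    q.map (fun s => Function.update (Function.update x₀ a s) b (φ s)) ∈
      observedModel.{uO, uL, uX, uΩ} G X := by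
  classical
  set h : X a → ∀ o, X o := fun s => Function.update (Function.update x₀ a s) b (φ s) with hh
  have ha : ∀ s, h s a = s := fun s => by simp [hh, hab]
  -- The latents are trivial; each observed vertex other than `a` is a point mass at `h (x a) o`,
  -- which really varies with `x a` only for `o = b`.
  refine ⟨fun _ => PUnit, fun _ => inferInstance, fun _ => Measure.dirac PUnit.unit,
    fun _ => inferInstance,
    fun v x _ => Sum.elim
      (fun o => if o = a then q (x a) else if x o = h (x a) o then 1 else 0) (fun _ => 1) v,
    ⟨fun v x => measurable_const, ?_, ?_, ?_⟩, fun x => ?_⟩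
  · rintro (o | l) x x' - - hx -
    · simp only [Sum.elim_inl]
      by_cases hoa : o = a
      · subst hoa
        rw [if_pos rfl, if_pos rfl, hx o (Or.inl rfl)]
      rw [if_neg hoa, if_neg hoa, hx o (Or.inl rfl)]
      by_cases hob : o = b
      · subst hob
        rw [hx a (Or.inr hG)]
      · simp [hh, hoa, hob]
    · rfl
  · intro o x u
    simp only [Sum.elim_inl]
    by_cases hoa : o = a
    · subst hoa
      simp [q.tsum_coe]
    · simp [hoa, Function.update_of_ne (Ne.symm hoa)]
  · intro l x u
    simp
  · simp only [lintegral_const, measure_univ, mul_one, Fintype.prod_sum_type, Sum.elim_inl,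
      Sum.elim_inr, Finset.prod_const_one]
    rw [PMF.map_apply]
    -- The `a` coordinate of `h s` is `s`, so `x a` is the only possible preimage of `x`.
    refine (tsum_eq_single (x a) fun s hs => if_neg fun e => hs (by rw [e, ha])).trans ?_
    rw [← Finset.mul_prod_erase _ _ (Finset.mem_univ a), if_pos rfl,
      Finset.prod_congr rfl fun o ho => if_neg (Finset.ne_of_mem_erase ho), Finset.prod_ite_zero]
    have : x = h (x a) ↔ ∀ o ∈ Finset.univ.erase a, x o = h (x a) o := by
      refine ⟨fun e o _ => congrFun e o, fun e => funext fun o => ?_⟩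
      by_cases hoa : o = a
      · subst hoa
        exact (ha _).symm
      · exact e o (Finset.mem_erase.2 ⟨hoa, Finset.mem_univ o⟩)
    simp only [← this, Finset.prod_const_one, mul_ite, mul_one, mul_zero]
    congr

end

end LatentDAG

/-- The vertices are `O ⊕ L` (observed, latent); `G` is a DAG whose latent vertices have no parents;
`a`, `b` are observed vertices, neither adjacent nor sharing a latent parent, such that adding
`a → b` gives a DAG again. For all discrete state spaces of the observed variables (those of `a`, `b`
with at least two points) the observed model strictly grows. -/
theorem corollary2 {O : Type uO} {L : Type uL} [Fintype O] [Fintype L]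
    [DecidableEq O] [DecidableEq L]
    (G : Digraph (O ⊕ L)) (hG : LatentDAG.IsAcyclic G)
    (hlatent : ∀ (v : O ⊕ L) (l : L), ¬ G.Adj v (Sum.inr l))
    (a b : O) (hab : a ≠ b)
    (hadj : ¬ G.Adj (Sum.inl a) (Sum.inl b) ∧ ¬ G.Adj (Sum.inl b) (Sum.inl a))
    (hconf : ¬ ∃ l : L, G.Adj (Sum.inr l) (Sum.inl a) ∧ G.Adj (Sum.inr l) (Sum.inl b))
    (hG' : LatentDAG.IsAcyclic (LatentDAG.addEdge G (Sum.inl a) (Sum.inl b)))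
    (X : O → Type uX) [∀ o, Countable (X o)] [∀ o, Nonempty (X o)]
    [Nontrivial (X a)] [Nontrivial (X b)] :
    LatentDAG.observedModel.{uO, uL, uX, uΩ} G X ⊂
      LatentDAG.observedModel.{uO, uL, uX, uΩ}
        (LatentDAG.addEdge G (Sum.inl a) (Sum.inl b)) X := by
  classical
  obtain ⟨s, s', hs⟩ := exists_pair_ne (X a)
  obtain ⟨t, t', ht⟩ := exists_pair_ne (X b)
  let x₀ : ∀ o, X o := fun o => Classical.arbitrary _
  -- With `q` uniform on `{s, s'}`, this correlates the two coordinates perfectly.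
  let φ : X a → X b := fun c => if c = s then t else t'
  let q : PMF (X a) := PMF.uniformOfFinset {s, s'} ⟨s, by simp⟩
  let p := q.map fun c => Function.update (Function.update x₀ a c) b (φ c)
  have hle : ∀ c ∈ ({s, s'} : Finset (X a)),
      2⁻¹ ≤ p (Function.update (Function.update x₀ a c) b (φ c)) := fun c hc => by
    have hq : q c = 2⁻¹ := by
      refine (PMF.uniformOfFinset_apply_of_mem _ hc).trans ?_
      rw [Finset.card_pair hs]
      norm_num
    rw [← hq, PMF.map_apply]
    exact (if_pos rfl).ge.trans (ENNReal.le_tsum c)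
  refine ⟨LatentDAG.observedModel_mono fun _ _ => Or.inl, fun hsub => ?_⟩
  obtain ⟨A, B, hA, hB, hAB⟩ := LatentDAG.exists_le_mul_of_mem_observedModel hlatent hab hadj
    hconf (hsub (LatentDAG.map_update_mem_observedModel hab (Or.inr ⟨rfl, rfl⟩) x₀ φ q)) x₀
  have h1 := (hle s (by simp)).trans (hAB s (φ s))
  have h2 := (hle s' (by simp)).trans (hAB s' (φ s'))
  rw [show φ s = t from if_pos rfl] at h1
  rw [show φ s' = t' from if_neg hs.symm] at h2
  exact LatentDAG.not_half_le_mul (hA s s' hs) (hB t t' ht) h1 h2
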